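/- All graphs are simple. For a connected graph $G$ let $\hat V(G)$ be the set of its vertices and (vertex-)ends. A set $X\subseteq\hat V(G)$ lives in a subgraph $C$ if all vertices in $X$ lie in $C$ and all rays of ends in $X$ have tails in $C$. A set $F$ of edges distinguishes $X,Y\subseteq \hat V(G)$ if $X$ and $Y$ live in distinct components of $G-F$; it does so efficiently if no edge set of smaller size distinguishes $X$ and $Y$. For $k\in\mathbb N\cup\{\infty\}$, the $k$-edge-blocks of $G$ are the classes of the equivalence relation on $\hat V(G)$ of not being separated (distinguished, as singletons) by fewer than $k$ edges; an edge-block is a $k$-edge-block for some $k$. A cut is an edge set $E(A,B)$ for a bipartition $\{A,B\}$ of $V(G)$ (the cut-separation inducing it) into non-empty sides; two cuts are nested if some side of one is included in some side of the other. A set of cuts efficiently distinguishes all edge-blocks of $G$ if every two disjoint edge-blocks are efficiently distinguished by a cut in it. A cut-separation distinguishes two edge-blocks efficiently if its cut does. A tree-cut decomposition of $G$ is a tree $T$ with a family $(X_t)_{t\in T}$ of pairwise disjoint, possibly empty, sets with union $V(G)$, such that every edge of $T$ lies on a path in $T$ between two nodes with non-empty parts; its fundamental cuts are the cuts $E(\bigcup_{t\in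 T_1}X_t,\bigcup_{t\in T_2}X_t)$, where $T_1,T_2$ are the components of $T-e$ for an edge $e$ of $T$. Let $G$ be the following graph. For every $n\ge 1$ take a complete graph on a set $B_n$ of $2^{n+2}$ vertices, among them distinct vertices $u^n_1,\dots,u^n_{2^n},v^n_1,\dots,v^n_{2^{n+1}}$, and $n+2$ further vertices $w^n_1,\dots,w^n_{n+2}$. For all $n\ge1$ add the edges $v^n_iu^{n+1}_i$ ($1\le i\le 2^{n+1}$) and all edges $w^n_iw^{n+1}_j$; for $n\ge2$ add the edge $u^n_1w^n_1$. Finally add a disjoint complete graph on a set $B_0$ of $10$ vertices, join one vertex $v^0_1\in B_0$ to $u^1_1$ and $u^1_2$, and join another vertex $w^0_1\in B_0$ to $w^1_1,w^1_2,w^1_3$. Put $V=V(G)$, $F_0=\{B_0,V\setminus B_0\}$ and $F_n=\{\bigcup_{k=1}^nB_k,\,V\setminus\bigcup_{k=1}^nB_k\}$ for $n\ge1$. Then: 1. $G$ is connected and locally finite. 2. $B_0$ is a $9$-edge-block of $G$, and $B_n$ is a $(2^{n+2}-1)$-edge-block of $G$ for every $n\ge1$. 3. For every $n\ge0$, $F_n$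 is the only cut-separation of $G$ that efficiently distinguishes $B_n$ and $B_{n+1}$. 4. With respect to the order $(A,B)\le(C,D):\Leftrightarrow A\subseteq C\text{ and }B\supseteq D$, the $F_n$ define a chain of order type $\omega+1$: $$(B_1,V\setminus B_1)<(B_1\cup B_2,V\setminus(B_1\cup B_2))<\dots<(V\setminus B_0,B_0).$$ 5. Every nested set of cuts that efficiently distinguishes all edge-blocks of $G$ contains the cuts corresponding to all the $F_n$, $n\ge 0$. 6. No nested set of cuts that efficiently distinguishes all edge-blocks of $G$ is the set of fundamental cuts of a tree-cut decomposition of $G$. (In particular this applies to every nested set $N$ of bonds, i.e. cuts with connected sides, that efficiently distinguishes all edge-blocks of $G$.) -/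

import Mathlib

namespace EdgeBlocks

universe u v

variable {V : Type u}

/-! ### Rays and ends -/

/-- A ray of `G`: a one-way infinite path. -/
structure Ray (G : SimpleGraph V) where
  vert : ℕ → V
  inj : Function.Injective vert
  adj : ∀ i, G.Adj (vert i) (vert (i + 1))

/-- For a vertex set `X`, the ray `R` has a tail in the component `C` of `G - X`. -/
def Ray.HasTailInCompl {G : SimpleGraph V} (R : Ray G) {X : Set V} (C : G.ComponentCompl X) :
    Prop :=
  ∃ m : ℕ, ∀ i, m ≤ i → R.vert i ∈ (C : Set V)

/-- Two rays are equivalent if for every finite vertex set `X` both have a tail in the same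
component of `G - X`. -/
def Ray.Equivalent {G : SimpleGraph V} (R S : Ray G) : Prop :=
  ∀ X : Set V, X.Finite → ∃ C : G.ComponentCompl X, R.HasTailInCompl C ∧ S.HasTailInCompl C

theorem Ray.equivalent_refl {G : SimpleGraph V} (R : Ray G) : R.Equivalent R := by
  intro X hX
  have hfin : {i : ℕ | R.vert i ∈ X}.Finite := hX.preimage R.inj.injOn
  obtain ⟨m, hm⟩ := hfin.bddAbove
  have hout : ∀ i, m + 1 ≤ i → R.vert i ∉ X := by
    intro i hi hmem
    have : i ≤ m := hm hmem
    omega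
  let C : G.ComponentCompl X := G.componentComplMk (hout (m + 1) le_rfl)
  have htail : R.HasTailInCompl C := by
    refine ⟨m + 1, fun i hi => ?_⟩
    induction i, hi using Nat.le_induction with
    | base => exact G.componentComplMk_mem _
    | succ i hi ih =>
      exact SimpleGraph.ComponentCompl.mem_of_adj _ _ ih (hout _ (by omega)) (R.adj i)
  exact ⟨C, htail, htail⟩

theorem Ray.equivalent_trans {G : SimpleGraph V} {R S T : Ray G} (h₁ : R.Equivalent S)
    (h₂ : S.Equivalent T) : R.Equivalent T := by
  intro X hX
  obtain ⟨C, hR, m, hm⟩ := h₁ X hX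
  obtain ⟨D, ⟨n, hn⟩, hT⟩ := h₂ X hX
  have hCD : C = D := by
    by_contra hne
    exact Set.disjoint_left.1 (SimpleGraph.ComponentCompl.pairwise_disjoint hne)
      (hm (max m n) (le_max_left _ _)) (hn (max m n) (le_max_right _ _))
  subst hCD
  exact ⟨C, hR, hT⟩

def raySetoid (G : SimpleGraph V) : Setoid (Ray G) where
  r := Ray.Equivalent
  iseqv := ⟨Ray.equivalent_refl,
    fun h X hX => let ⟨C, hC⟩ := h X hX; ⟨C, hC.2, hC.1⟩, Ray.equivalent_trans⟩

/-- The (vertex-)ends of `G`. -/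
def GraphEnd (G : SimpleGraph V) : Type u := Quotient (raySetoid G)

/-- `Vhat G` is the set of all vertices and ends of `G`. -/
abbrev Vhat (G : SimpleGraph V) : Type u := V ⊕ GraphEnd G

/-! ### Edge-blocks -/

/-- The ray `R` of `G` has a tail in the component `C` of the subgraph `H`: from some index on,
all vertices of `R` lie in `C` and all edges of `R` are edges of `H`. -/
def Ray.HasTailIn {G : SimpleGraph V} (R : Ray G) {H : SimpleGraph V}
    (C : H.ConnectedComponent) : Prop :=
  ∃ m : ℕ, ∀ i, m ≤ i → R.vert i ∈ C.supp ∧ H.Adj (R.vert i) (R.vert (i + 1))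

/-- A set `X` of vertices and ends of `G` lives in the component `C` of the subgraph `H`. -/
def LivesIn {G : SimpleGraph V} (X : Set (Vhat G)) {H : SimpleGraph V}
    (C : H.ConnectedComponent) : Prop :=
  (∀ x : V, Sum.inl x ∈ X → x ∈ C.supp) ∧
    ∀ R : Ray G, Sum.inr (Quotient.mk (raySetoid G) R) ∈ X → R.HasTailIn C

/-- The edge set `F` distinguishes `X` and `Y`: they live in distinct components of `G - F`. -/
def Distinguishes (G : SimpleGraph V) (F : Set (Sym2 V)) (X Y : Set (Vhat G)) : Prop :=
  F ⊆ G.edgeSet ∧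
    ∃ C D : (G.deleteEdges F).ConnectedComponent, C ≠ D ∧ LivesIn X C ∧ LivesIn Y D

/-- `F` distinguishes `X` and `Y`, and no edge set of smaller size does. -/
def DistinguishesEfficiently (G : SimpleGraph V) (F : Set (Sym2 V)) (X Y : Set (Vhat G)) :
    Prop :=
  Distinguishes G F X Y ∧ ∀ F' : Set (Sym2 V), Distinguishes G F' X Y → F.encard ≤ F'.encard

/-- `x` and `y` cannot be separated in `G` by fewer than `k` edges
(for `k = ⊤`: by finitely many edges). -/
def Inseparable (G : SimpleGraph V) (k : ℕ∞) (x y : Vhat G) : Prop :=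
  ∀ F : Set (Sym2 V), F.encard < k → ¬ Distinguishes G F {x} {y}

/-- The `k`-edge-blocks are the equivalence classes of `Inseparable G k`. -/
def IsKEdgeBlock (G : SimpleGraph V) (k : ℕ∞) (X : Set (Vhat G)) : Prop :=
  ∃ x : Vhat G, X = {y | Inseparable G k x y}

def IsEdgeBlock (G : SimpleGraph V) (X : Set (Vhat G)) : Prop :=
  ∃ k : ℕ∞, IsKEdgeBlock G k X

/-! ### Cuts -/

/-- The set `E(A, B)` of all edges of `G` with one end in `A` and the other in `B`. -/
def edgesBetween (G : SimpleGraph V) (A B : Set V) : Set (Sym2 V) :=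
  {e | ∃ a ∈ A, ∃ b ∈ B, G.Adj a b ∧ e = s(a, b)}

/-- `A` is a side of `F`, that is, `F` is the cut `E(A, V ∖ A)` and both sides are non-empty. -/
def IsSideOf (G : SimpleGraph V) (A : Set V) (F : Set (Sym2 V)) : Prop :=
  A.Nonempty ∧ Aᶜ.Nonempty ∧ F = edgesBetween G A Aᶜ

def IsCut (G : SimpleGraph V) (F : Set (Sym2 V)) : Prop :=
  ∃ A : Set V, IsSideOf G A F

/-- Two cuts are nested if some side of the first is included in some side of the second. -/
def Nested (G : SimpleGraph V) (F₁ F₂ : Set (Sym2 V)) : Prop :=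
  ∃ A₁ A₂ : Set V, IsSideOf G A₁ F₁ ∧ IsSideOf G A₂ F₂ ∧ A₁ ⊆ A₂

def IsNestedSetOfCuts (G : SimpleGraph V) (M : Set (Set (Sym2 V))) : Prop :=
  (∀ F ∈ M, IsCut G F) ∧ ∀ F₁ ∈ M, ∀ F₂ ∈ M, Nested G F₁ F₂

/-- Every two disjoint edge-blocks of `G` are distinguished efficiently by an element of `M`. -/
def DistinguishesAllEfficiently (G : SimpleGraph V) (M : Set (Set (Sym2 V))) : Prop :=
  ∀ X Y : Set (Vhat G), IsEdgeBlock G X → IsEdgeBlock G Y → Disjoint X Y →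
    ∃ F ∈ M, DistinguishesEfficiently G F X Y

/-! ### Tree-cut decompositions -/

/-- A tree-cut decomposition of a graph on `V`, with decomposition tree on `ι`: the parts
near-partition `V` and the nodes with non-empty parts are dense in the tree. -/
structure TreeCutDecomposition (V : Type u) (ι : Type v) where
  tree : SimpleGraph ι
  isTree : tree.IsTree
  part : ι → Set V
  disjoint : Pairwise fun s t => Disjoint (part s) (part t)
  cover : ⋃ t, part t = Set.univ
  dense : ∀ e ∈ tree.edgeSet, ∃ s t : ι, (part s).Nonempty ∧ (part t).Nonempty ∧
    ∃ p : tree.Walk s t, p.IsPath ∧ e ∈ p.edges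

/-- For an edge `t₁t₂` of the tree, the union of all parts at nodes in the component of
`T - t₁t₂` that contains `t₁`. -/
def TreeCutDecomposition.side {ι : Type v} (D : TreeCutDecomposition V ι) (t₁ t₂ : ι) : Set V :=
  ⋃ t ∈ {t | (D.tree.deleteEdges {s(t₁, t₂)}).Reachable t₁ t}, D.part t

/-- The set of fundamental cuts of a tree-cut decomposition of `G`. -/
def TreeCutDecomposition.fundamentalCuts (G : SimpleGraph V) {ι : Type v}
    (D : TreeCutDecomposition V ι) : Set (Set (Sym2 V)) :=
  {F | ∃ t₁ t₂ : ι, D.tree.Adj t₁ t₂ ∧ F = edgesBetween G (D.side t₁ t₂) (D.side t₂ t₁)}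

/-- Oriented separations `(A, B)`, with `(A, B) ≤ (C, D)` if and only if `A ⊆ C` and `D ⊆ B`. -/
abbrev OrientedSep (V : Type u) : Type u := Set V × (Set V)ᵒᵈ

/-! ### The example graph -/

/-- The order of the `n`-th complete graph: `10` for `n = 0` and `2 ^ (n + 2)` for `n ≥ 1`. -/
def cliqueSize (n : ℕ) : ℕ := if n = 0 then 10 else 2 ^ (n + 2)

/-- The vertices of the example graph, with lower indices starting at `0`.
`clique n 0, clique n 1, …` are the vertices of the `n`-th complete graph and, for `n ≥ 1`,
`w n i` is the additional vertex `w_{i+1}^n`. For `n ≥ 1` we select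
`u_{i+1}^n = clique n i` for `i < 2 ^ n` and `v_{i+1}^n = clique n (2 ^ n + i)` for
`i < 2 ^ (n + 1)`; for `n = 0` we select `v_1^0 = clique 0 0` and `w_1^0 = clique 0 1`. -/
inductive ExVertex : Type
  | clique (n i : ℕ) (hi : i < cliqueSize n) : ExVertex
  | w (n i : ℕ) (hn : 1 ≤ n) (hi : i < n + 2) : ExVertex

/-- The edges of the example graph, each in (at least) one direction. -/
inductive ExEdge : ExVertex → ExVertex → Prop
  | complete (n i j : ℕ) (hi : i < cliqueSize n) (hj : j < cliqueSize n) (hij : i ≠ j) :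
      ExEdge (.clique n i hi) (.clique n j hj)
  | red (n i : ℕ) (hn : 1 ≤ n) (hi : i < 2 ^ (n + 1)) (h : 2 ^ n + i < cliqueSize n)
      (h' : i < cliqueSize (n + 1)) :
      ExEdge (.clique n (2 ^ n + i) h) (.clique (n + 1) i h')
  | blue (n i j : ℕ) (hn : 1 ≤ n) (hi : i < n + 2) (hn' : 1 ≤ n + 1) (hj : j < n + 1 + 2) :
      ExEdge (.w n i hn hi) (.w (n + 1) j hn' hj)
  | black (n : ℕ) (hn : 2 ≤ n) (h : 0 < cliqueSize n) (hn' : 1 ≤ n) (h' : 0 < n + 2) :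
      ExEdge (.clique n 0 h) (.w n 0 hn' h')
  | redZero (i : ℕ) (hi : i < 2) (h : 0 < cliqueSize 0) (h' : i < cliqueSize 1) :
      ExEdge (.clique 0 0 h) (.clique 1 i h')
  | blueZero (i : ℕ) (h : 1 < cliqueSize 0) (hn : 1 ≤ 1) (hi : i < 1 + 2) :
      ExEdge (.clique 0 1 h) (.w 1 i hn hi)

/-- The example graph. -/
def exGraph : SimpleGraph ExVertex := SimpleGraph.fromRel ExEdge

/-- The vertex set `B_n` of the `n`-th complete graph. -/
def exB (n : ℕ) : Set ExVertex := {x | ∃ (i : ℕ) (hi : i < cliqueSize n), x = .clique n i hi}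

/-- `B_n` as a set of vertices and ends. -/
def exBlock (n : ℕ) : Set (Vhat exGraph) := Sum.inl '' exB n

/-- One side of the cut-separation `F_n`: it is `B_0` for `n = 0` and `B_1 ∪ ⋯ ∪ B_n`
for `n ≥ 1`. -/
def exSide (n : ℕ) : Set ExVertex := if n = 0 then exB 0 else ⋃ k ∈ Set.Icc 1 n, exB k

/-- The cut corresponding to the cut-separation `F_n`. -/
def exCut (n : ℕ) : Set (Sym2 ExVertex) := edgesBetween exGraph (exSide n) (exSide n)ᶜ

/-- The family of orientations of the `F_n`, indexed by `ω + 1`: at `n < ω` it is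
`(B_1 ∪ ⋯ ∪ B_{n+1}, V ∖ (B_1 ∪ ⋯ ∪ B_{n+1}))`, at `ω` it is `(V ∖ B_0, B_0)`. -/
def exChain : WithTop ℕ → OrientedSep ExVertex
  | (n : ℕ) => (exSide (n + 1), OrderDual.toDual (exSide (n + 1))ᶜ)
  | ⊤ => ((exSide 0)ᶜ, OrderDual.toDual (exSide 0))

end EdgeBlocks

open EdgeBlocks

namespace EdgeBlocks

/-! ### Cuts, components of `G - F`, and cliques as edge-blocks. -/

section Cuts

variable {V : Type*} {G : SimpleGraph V}

/-! Everything rests on the uniqueness of the minimum cut between `B_n` and `B_{n+1}`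
(`eq_exSide_of_encard_le`). Let `A` contain `B_n`, avoid `B_{n+1}` and have a boundary no larger
than that of `exSide n`. All `2 ^ (n + 1)` red edges at `n` cross, so only `exExtra n` further edges
may. Above level `n` this is too few to split a clique, to put `B_{k+1}` in `A` but not `B_k`, or to
stop the `w`'s in `A` from spreading upwards. If one `w` at level at least `n` were in `A`, then
some `w` of every later level would be, and black edges would make the cut infinite. Below `n` one
descends: each level already settled contributes a black edge to the cut, so at level `j` only `j +
1` edges are left, again too few for any deviation. Hence `A = exSide n`.

A component of `G - F` has its boundary in `F`, so any efficient distinguisher of `B_n` and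
`B_{n+1}` is `exCut n`. Each `B_n` is an edge-block because fewer than `|B_n| - 1` edges leave it,
while splitting a clique `K` costs at least `|K| - 1` edges. So every set of cuts that efficiently
distinguishes all edge-blocks contains all `exCut n`.

The cuts `exCut (n + 1)` all separate `B_1` from `B_0`. In a tree-cut decomposition, only the
finitely many tree edges on the path between two nodes give cuts separating their parts
(`finite_separating_cuts`), so infinitely many such cuts are impossible. -/

theorem edgesBetween_comm (A B : Set V) : edgesBetween G A B = edgesBetween G B A := by
  ext e
  constructor <;> rintro ⟨a, ha, b, hb, h, rfl⟩ <;> exact ⟨b, hb, a, ha, h.symm, Sym2.eq_swap⟩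

theorem mk_mem_edgesBetween_compl {A : Set V} {a b : V} :
    s(a, b) ∈ edgesBetween G A Aᶜ ↔ G.Adj a b ∧ ¬ (a ∈ A ↔ b ∈ A) := by
  constructor
  · rintro ⟨x, hx, y, hy, h, e⟩
    rcases Sym2.eq_iff.1 e with ⟨rfl, rfl⟩ | ⟨rfl, rfl⟩
    · exact ⟨h, fun H => hy (H.1 hx)⟩
    · exact ⟨h.symm, fun H => hy (H.2 hx)⟩
  · rintro ⟨h, hab⟩
    by_cases ha : a ∈ A
    · exact ⟨a, ha, b, fun hb => hab ⟨fun _ => hb, fun _ => ha⟩, h, rfl⟩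
    · refine ⟨b, ?_, a, ha, h.symm, Sym2.eq_swap⟩
      by_contra hb
      exact hab ⟨fun h => absurd h ha, fun h => absurd h hb⟩

/-- The edges of the cut `E(A, V ∖ A)`, oriented from `A` to its complement. -/
def cutDarts (G : SimpleGraph V) (A : Set V) : Set (V × V) :=
  {p | p.1 ∈ A ∧ p.2 ∉ A ∧ G.Adj p.1 p.2}

theorem encard_cutDarts (A : Set V) :
    (cutDarts G A).encard = (edgesBetween G A Aᶜ).encard := by
  have h : edgesBetween G A Aᶜ = (fun p : V × V => s(p.1, p.2)) '' cutDarts G A := by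
    ext e
    constructor
    · rintro ⟨a, ha, b, hb, h, rfl⟩
      exact ⟨(a, b), ⟨ha, hb, h⟩, rfl⟩
    · rintro ⟨⟨a, b⟩, ⟨ha, hb, h⟩, rfl⟩
      exact ⟨a, ha, b, hb, h, rfl⟩
  rw [h, Set.InjOn.encard_image]
  rintro ⟨a, b⟩ ⟨ha, hb, -⟩ ⟨c, d⟩ ⟨hc, hd, -⟩ e
  rcases Sym2.eq_iff.1 e with ⟨h₁, h₂⟩ | ⟨h₁, h₂⟩
  · exact Prod.ext h₁ h₂
  · exact absurd (show a = d from h₁) (fun h => hd (h ▸ ha))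

theorem edgesBetween_supp_subset {F : Set (Sym2 V)}
    (C : (G.deleteEdges F).ConnectedComponent) : edgesBetween G C.supp C.suppᶜ ⊆ F := by
  rintro _ ⟨a, ha, b, hb, h, rfl⟩
  by_contra hF
  exact hb (C.mem_supp_of_adj_mem_supp ha (SimpleGraph.deleteEdges_adj.2 ⟨h, hF⟩))

theorem mem_iff_of_reachable_deleteEdges {A : Set V} {x y : V}
    (h : (G.deleteEdges (edgesBetween G A Aᶜ)).Reachable x y) : x ∈ A ↔ y ∈ A := by
  obtain ⟨p⟩ := h
  induction p with
  | nil => rfl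
  | cons h _ ih =>
    rw [SimpleGraph.deleteEdges_adj, mk_mem_edgesBetween_compl] at h
    rw [← ih]
    by_contra H
    exact h.2 ⟨h.1, H⟩

/-- An edge crosses `A` exactly when it crosses `B`, so the truth value of `x ∈ A ↔ x ∈ B` is
constant along walks. -/
theorem eq_or_eq_compl_of_edgesBetween_eq (hG : G.Connected) {A B : Set V}
    (h : edgesBetween G A Aᶜ = edgesBetween G B Bᶜ) : A = B ∨ A = Bᶜ := by
  have step : ∀ x y, G.Reachable x y → ((x ∈ A ↔ x ∈ B) ↔ (y ∈ A ↔ y ∈ B)) := by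
    rintro x y ⟨p⟩
    induction p with
    | nil => rfl
    | @cons u v w huv _ ih =>
      have := Set.ext_iff.1 h s(u, v)
      rw [mk_mem_edgesBetween_compl, mk_mem_edgesBetween_compl] at this
      rw [← ih]
      tauto
  obtain ⟨x⟩ := hG.nonempty
  by_cases hx : x ∈ A ↔ x ∈ B
  · left
    ext y
    exact (step x y (hG.preconnected x y)).1 hx
  · right
    ext y
    have := step x y (hG.preconnected x y)
    rw [Set.mem_compl_iff]
    tauto

theorem edgesBetween_compl_compl (A : Set V) :
    edgesBetween G Aᶜ Aᶜᶜ = edgesBetween G A Aᶜ := by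
  rw [compl_compl, edgesBetween_comm]

/-- A cut distinguishes any two cliques on different sides. -/
theorem distinguishes_of_isClique {A S T : Set V} (hS : G.IsClique S) (hT : G.IsClique T)
    (hS₀ : S.Nonempty) (hT₀ : T.Nonempty) (hSA : S ⊆ A) (hTA : T ⊆ Aᶜ) :
    Distinguishes G (edgesBetween G A Aᶜ) (Sum.inl '' S) (Sum.inl '' T) := by
  have lives : ∀ {U : Set V} {z : V}, G.IsClique U → z ∈ U →
      (∀ x ∈ U, ∀ y ∈ U, x ∈ A ↔ y ∈ A) →
      LivesIn (G := G) (Sum.inl '' U)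
        ((G.deleteEdges (edgesBetween G A Aᶜ)).connectedComponentMk z) := by
    intro U z hU hz hUA
    refine ⟨?_, ?_⟩
    · rintro x ⟨y, hy, e⟩
      obtain rfl : y = x := Sum.inl_injective e
      rw [SimpleGraph.ConnectedComponent.mem_supp_iff, SimpleGraph.ConnectedComponent.eq]
      by_cases hyz : y = z
      · rw [hyz]
      · refine (SimpleGraph.deleteEdges_adj.2 ⟨hU hy hz hyz, ?_⟩).reachable
        rw [mk_mem_edgesBetween_compl]
        exact fun h => h.2 (hUA y hy z hz)
    · rintro R ⟨y, hy, e⟩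
      cases e
  obtain ⟨s, hs⟩ := hS₀
  obtain ⟨t, ht⟩ := hT₀
  refine ⟨?_, _, _, ?_, lives hS hs ?_, lives hT ht ?_⟩
  · rintro _ ⟨a, -, b, -, h, rfl⟩
    exact h
  · rw [Ne, SimpleGraph.ConnectedComponent.eq]
    intro h
    exact hTA ht ((mem_iff_of_reachable_deleteEdges h).1 (hSA hs))
  · exact fun x hx y hy => ⟨fun _ => hSA hy, fun _ => hSA hx⟩
  · exact fun x hx y hy => ⟨fun h => absurd h (hTA hx), fun h => absurd h (hTA hy)⟩

theorem reachable_of_mem_componentCompl {B : Set V} {C : G.ComponentCompl B} {x y : V}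
    (hx : x ∈ C) (hy : y ∈ C) : (G.deleteEdges (edgesBetween G B Bᶜ)).Reachable x y := by
  obtain ⟨hx', ex⟩ := hx
  obtain ⟨hy', ey⟩ := hy
  have h : (G.induce Bᶜ).Reachable ⟨x, hx'⟩ ⟨y, hy'⟩ :=
    SimpleGraph.ConnectedComponent.exact (ex.trans ey.symm)
  let f : G.induce Bᶜ →g G.deleteEdges (edgesBetween G B Bᶜ) :=
    { toFun := Subtype.val
      map_rel' := by
        rintro ⟨a, ha⟩ ⟨b, hb⟩ hab
        refine SimpleGraph.deleteEdges_adj.2 ⟨hab, ?_⟩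
        rw [mk_mem_edgesBetween_compl]
        exact fun h => h.2 ⟨fun h => absurd h ha, fun h => absurd h hb⟩ }
  exact h.map f

/-- The cut around a finite vertex set distinguishes its elements from every other vertex and from
every end. -/
theorem distinguishes_of_finite {B : Set V} (hB : B.Finite) {b : V} (hb : b ∈ B) {p : Vhat G}
    (hp : p ∉ (Sum.inl '' B : Set (Vhat G))) :
    Distinguishes G (edgesBetween G B Bᶜ) {Sum.inl b} {p} := by
  have hbC : LivesIn (G := G) {Sum.inl b}
      ((G.deleteEdges (edgesBetween G B Bᶜ)).connectedComponentMk b) := by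
    refine ⟨?_, ?_⟩
    · rintro x hx
      obtain rfl : x = b := Sum.inl_injective hx
      rfl
    · rintro R hR
      cases hR
  have main : ∀ z, z ∉ B → LivesIn {p}
      ((G.deleteEdges (edgesBetween G B Bᶜ)).connectedComponentMk z) →
      Distinguishes G (edgesBetween G B Bᶜ) {Sum.inl b} {p} := by
    intro z hz hpz
    refine ⟨?_, _, _, ?_, hbC, hpz⟩
    · rintro _ ⟨a, -, b, -, h, rfl⟩
      exact h
    · rw [Ne, SimpleGraph.ConnectedComponent.eq]
      exact fun h => hz ((mem_iff_of_reachable_deleteEdges h).1 hb)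
  rcases p with y | e
  · refine main y (fun hy => hp ⟨y, hy, rfl⟩) ⟨?_, ?_⟩
    · rintro x hx
      obtain rfl : x = y := Sum.inl_injective hx
      rfl
    · rintro R hR
      cases hR
  · obtain ⟨R, rfl⟩ := Quotient.exists_rep e
    -- Since `B` is finite, a tail of `R` avoids it and stays in one component of `G - B`; rays of
    -- the same end have tails in that component too.
    obtain ⟨C, ⟨m, hm⟩, -⟩ := R.equivalent_refl B hB
    have hout : ∀ {C : G.ComponentCompl B} {x : V}, x ∈ C → x ∉ B := fun h => h.1
    refine main (R.vert m) (hout (hm m le_rfl)) ⟨?_, ?_⟩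
    · rintro x hx
      cases hx
    · intro S hS
      have hSR : S.Equivalent R := Quotient.exact (Sum.inr_injective hS)
      obtain ⟨C', ⟨k, hk⟩, l, hl⟩ := hSR B hB
      refine ⟨k, fun i hi => ⟨?_, ?_⟩⟩
      · rw [SimpleGraph.ConnectedComponent.mem_supp_iff, SimpleGraph.ConnectedComponent.eq]
        exact (reachable_of_mem_componentCompl (hk i hi) (hl (max m l) (le_max_right _ _))).trans
          (reachable_of_mem_componentCompl (hm _ (le_max_left _ _)) (hm m le_rfl))
      · refine SimpleGraph.deleteEdges_adj.2 ⟨S.adj i, ?_⟩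
        rw [mk_mem_edgesBetween_compl]
        have h₁ := hout (hk i hi)
        have h₂ := hout (hk (i + 1) (by omega))
        exact fun h => h.2 ⟨fun h => absurd h h₁, fun h => absurd h h₂⟩

/-- A cut that splits a finite clique contains at least `|K| - 1` of its edges. -/
theorem exists_cutDarts_of_split {A : Set V} {K : Finset V} (hK : G.IsClique (K : Set V)) {x y : V}
    (hx : x ∈ K) (hy : y ∈ K) (hxA : x ∈ A) (hyA : y ∉ A) :
    ∃ S : Finset (V × V), (S : Set (V × V)) ⊆ cutDarts G A ∧ S.card = K.card - 1 ∧
      ∀ p ∈ S, p.1 ∈ K ∧ p.2 ∈ K := by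
  classical
  -- Each `z ≠ y` in `K` gets its own crossing edge: to `y` if `z` lies in `A`, and from `x`
  -- otherwise.
  have hmem : ∀ z ∈ K.erase y, (if z ∈ A then (z, y) else (x, z)) ∈ cutDarts G A ∧
      (if z ∈ A then (z, y) else (x, z)).1 ∈ K ∧ (if z ∈ A then (z, y) else (x, z)).2 ∈ K := by
    intro z hz
    obtain ⟨hzy, hzK⟩ := Finset.mem_erase.1 hz
    split_ifs with h
    · exact ⟨⟨h, hyA, hK hzK hy hzy⟩, hzK, hy⟩
    · exact ⟨⟨hxA, h, hK hx hzK (fun e : x = z => h (e ▸ hxA))⟩, hx, hzK⟩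
  refine ⟨(K.erase y).image fun z => if z ∈ A then (z, y) else (x, z), ?_, ?_, ?_⟩
  · intro p hp
    obtain ⟨z, hz, rfl⟩ := Finset.mem_image.1 (Finset.mem_coe.1 hp)
    exact (hmem z hz).1
  · rw [Finset.card_image_of_injOn, Finset.card_erase_of_mem hy]
    intro z hz z' hz' e
    have h₁ := (Finset.mem_erase.1 (Finset.mem_coe.1 hz)).1
    have h₂ := (Finset.mem_erase.1 (Finset.mem_coe.1 hz')).1
    by_cases h : z ∈ A <;> by_cases h' : z' ∈ A <;> simp_all
  · intro p hp
    obtain ⟨z, hz, rfl⟩ := Finset.mem_image.1 hp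
    exact (hmem z hz).2

/-- The vertices of a finite clique `K` are pairwise inseparable by fewer than `|K| - 1` edges. -/
theorem inseparable_of_isClique {K : Finset V} (hK : G.IsClique (K : Set V)) {x y : V}
    (hx : x ∈ K) (hy : y ∈ K) :
    Inseparable G ((K.card - 1 : ℕ) : ℕ∞) (Sum.inl x) (Sum.inl y) := by
  rintro F hF ⟨-, C, D, hCD, hC, hD⟩
  have hxC : x ∈ C.supp := hC.1 x rfl
  have hyC : y ∉ C.supp := fun h => hCD <|
    SimpleGraph.ConnectedComponent.eq_of_common_vertex h (hD.1 y rfl)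
  obtain ⟨S, hS, hcard, -⟩ := exists_cutDarts_of_split hK hx hy hxC hyC
  refine hF.not_ge ?_
  rw [← hcard, ← Set.encard_coe_eq_coe_finsetCard]
  exact (Set.encard_le_encard hS).trans
    ((encard_cutDarts _).trans_le (Set.encard_le_encard (edgesBetween_supp_subset C)))

/-- A finite clique around which there are fewer than `|K| - 1` edges is an edge-block. -/
theorem isKEdgeBlock_of_isClique {K : Finset V} (hK : G.IsClique (K : Set V)) (hK₀ : K.Nonempty)
    (hcut : (edgesBetween G (K : Set V) (K : Set V)ᶜ).encard < ((K.card - 1 : ℕ) : ℕ∞)) :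
    IsKEdgeBlock G ((K.card - 1 : ℕ) : ℕ∞) (Sum.inl '' (K : Set V)) := by
  obtain ⟨x, hx⟩ := hK₀
  refine ⟨Sum.inl x, Set.ext fun p => ⟨?_, fun hp => ?_⟩⟩
  · rintro ⟨y, hy, rfl⟩
    exact inseparable_of_isClique hK hx hy
  · by_contra h
    exact hp _ hcut (distinguishes_of_finite K.finite_toSet hx h)

end Cuts

/-! ### Fundamental cuts of tree-cut decompositions. -/

section TreeCut

variable {V : Type*} {ι : Type*} (D : TreeCutDecomposition V ι)

theorem TreeCutDecomposition.mem_side_iff {s t₁ t₂ : ι} {x : V} (hx : x ∈ D.part s) :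
    x ∈ D.side t₁ t₂ ↔ (D.tree.deleteEdges {s(t₁, t₂)}).Reachable t₁ s := by
  simp only [TreeCutDecomposition.side, Set.mem_iUnion, Set.mem_ofPred_eq]
  constructor
  · rintro ⟨t, ht, hxt⟩
    obtain rfl : t = s := by
      by_contra hne
      exact Set.disjoint_left.1 (D.disjoint hne) hxt hx
    exact ht
  · exact fun h => ⟨s, h, hx⟩

theorem reachable_or_reachable_of_deleteEdges {T : SimpleGraph ι} (hT : T.Connected) (t₁ t₂ s : ι) :
    (T.deleteEdges {s(t₁, t₂)}).Reachable t₁ s ∨ (T.deleteEdges {s(t₁, t₂)}).Reachable t₂ s := by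
  obtain ⟨p⟩ := hT.preconnected s t₁
  suffices h : ∀ {a b} (_ : T.Walk a b), b = t₁ →
      (T.deleteEdges {s(t₁, t₂)}).Reachable t₁ a ∨ (T.deleteEdges {s(t₁, t₂)}).Reachable t₂ a from
    h p rfl
  intro a b p
  induction p with
  | nil =>
    rintro rfl
    exact Or.inl .rfl
  | @cons u v w huv _ ih =>
    intro hw
    by_cases he : s(u, v) = s(t₁, t₂)
    · rcases Sym2.eq_iff.1 he with ⟨rfl, rfl⟩ | ⟨rfl, rfl⟩
      · exact Or.inl .rfl
      · exact Or.inr .rfl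
    · have : (T.deleteEdges {s(t₁, t₂)}).Reachable v u :=
        (SimpleGraph.deleteEdges_adj.2 ⟨huv, by simpa using he⟩).symm.reachable
      exact (ih hw).imp (·.trans this) (·.trans this)

theorem TreeCutDecomposition.side_swap {t₁ t₂ : ι} (h : D.tree.Adj t₁ t₂) :
    D.side t₂ t₁ = (D.side t₁ t₂)ᶜ := by
  ext x
  obtain ⟨s, hs⟩ := Set.mem_iUnion.1 (D.cover.symm ▸ Set.mem_univ x : x ∈ ⋃ t, D.part t)
  rw [Set.mem_compl_iff, D.mem_side_iff hs, D.mem_side_iff hs, Sym2.eq_swap]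
  constructor
  · intro h₂ h₁
    -- Every edge of a tree is a bridge, so the two sides are disjoint; they cover by connectedness
    -- of the tree.
    have := SimpleGraph.isAcyclic_iff_forall_adj_isBridge.1 D.isTree.isAcyclic h
    rw [SimpleGraph.isBridge_iff] at this
    exact this (h₁.trans h₂.symm)
  · exact (reachable_or_reachable_of_deleteEdges D.isTree.connected t₁ t₂ s).resolve_left

/-- Only finitely many fundamental cuts of a tree-cut decomposition separate two given vertices. -/
theorem TreeCutDecomposition.finite_separating_cuts (G : SimpleGraph V) (hG : G.Connected)
    (x y : V) :
    {F ∈ D.fundamentalCuts G | ∃ A, F = edgesBetween G A Aᶜ ∧ ¬ (x ∈ A ↔ y ∈ A)}.Finite := by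
  obtain ⟨s, hs⟩ := Set.mem_iUnion.1 (D.cover.symm ▸ Set.mem_univ x : x ∈ ⋃ t, D.part t)
  obtain ⟨t, ht⟩ := Set.mem_iUnion.1 (D.cover.symm ▸ Set.mem_univ y : y ∈ ⋃ t, D.part t)
  obtain ⟨p⟩ := D.isTree.connected.preconnected s t
  have hfin : {e : ι × ι | s(e.1, e.2) ∈ p.edges}.Finite := by
    classical
    refine (p.support.toFinset ×ˢ p.support.toFinset).finite_toSet.subset ?_
    rintro ⟨a, b⟩ hab
    simpa using ⟨p.fst_mem_support_of_mem_edges hab, p.snd_mem_support_of_mem_edges hab⟩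
  refine (hfin.image fun e => edgesBetween G (D.side e.1 e.2) (D.side e.2 e.1)).subset ?_
  rintro F ⟨⟨t₁, t₂, h, rfl⟩, A, hA, hxy⟩
  refine ⟨(t₁, t₂), ?_, rfl⟩
  by_contra hp
  rw [D.side_swap h] at hA
  -- An edge off the path from `s` to `t` leaves both nodes in the same component of the tree, so
  -- its cut does not separate `x` from `y`.
  have hreach : (D.tree.deleteEdges {s(t₁, t₂)}).Reachable s t :=
    ⟨p.toDeleteEdges _ fun e he h' => hp (show _ ∈ p.edges from Set.mem_singleton_iff.1 h' ▸ he)⟩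
  have key : x ∈ D.side t₁ t₂ ↔ y ∈ D.side t₁ t₂ := by
    rw [D.mem_side_iff hs, D.mem_side_iff ht]
    exact ⟨(·.trans hreach), (·.trans hreach.symm)⟩
  rcases eq_or_eq_compl_of_edgesBetween_eq hG hA with h | h
  · rw [h] at key
    exact hxy key
  · rw [h, Set.mem_compl_iff, Set.mem_compl_iff] at key
    exact hxy (not_iff_not.1 key)

end TreeCut

/-! ### The example graph. -/

section Example

theorem cliqueSize_of_pos {n : ℕ} (hn : 1 ≤ n) : cliqueSize n = 2 ^ (n + 2) :=
  if_neg (by omega)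

theorem one_lt_cliqueSize (n : ℕ) : 1 < cliqueSize n := by
  unfold cliqueSize
  split_ifs
  · norm_num
  · exact Nat.one_lt_two_pow (by omega)

theorem cliqueSize_pos (n : ℕ) : 0 < cliqueSize n :=
  Nat.zero_lt_one.trans (one_lt_cliqueSize n)

theorem two_pow_lt_cliqueSize_succ {n i : ℕ} (hi : i < 2 ^ (n + 1)) : i < cliqueSize (n + 1) := by
  rw [cliqueSize_of_pos (by omega)]
  exact hi.trans (Nat.pow_lt_pow_right (by norm_num) (by omega))

theorem two_pow_add_lt_cliqueSize {n i : ℕ} (hn : 1 ≤ n) (hi : i < 2 ^ (n + 1)) :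
    2 ^ n + i < cliqueSize n := by
  rw [cliqueSize_of_pos hn]
  rw [pow_succ] at hi
  rw [pow_succ, pow_succ]
  omega

/-- The superscript of a vertex. -/
def ExVertex.level : ExVertex → ℕ
  | clique n _ _ => n
  | w n _ _ _ => n

/-- The vertex is one of the `w n i`. -/
def ExVertex.IsW : ExVertex → Prop
  | clique _ _ _ => False
  | w _ _ _ _ => True

theorem clique_mem_exB {n m i : ℕ} {hi : i < cliqueSize m} :
    ExVertex.clique m i hi ∈ exB n ↔ m = n := by
  constructor
  · rintro ⟨j, hj, e⟩
    cases e
    rfl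
  · rintro rfl
    exact ⟨i, hi, rfl⟩

theorem w_notMem_exB {n m i : ℕ} {hm : 1 ≤ m} {hi : i < m + 2} :
    ExVertex.w m i hm hi ∉ exB n := by
  rintro ⟨j, hj, e⟩
  cases e

theorem mem_exB {n : ℕ} {x : ExVertex} : x ∈ exB n ↔ ¬ x.IsW ∧ x.level = n := by
  cases x with
  | clique m i hi => simp [clique_mem_exB, ExVertex.IsW, ExVertex.level]
  | w m i hm hi => simp [w_notMem_exB, ExVertex.IsW]

theorem exSide_zero : exSide 0 = exB 0 := if_pos rfl

theorem mem_exSide_of_pos {n : ℕ} (hn : 1 ≤ n) {x : ExVertex} :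
    x ∈ exSide n ↔ ¬ x.IsW ∧ 1 ≤ x.level ∧ x.level ≤ n := by
  have : exSide n = ⋃ k ∈ Set.Icc 1 n, exB k := if_neg (by omega)
  simp only [this, Set.mem_iUnion, mem_exB, Set.mem_Icc]
  constructor
  · rintro ⟨k, hk, h, rfl⟩
    exact ⟨h, hk⟩
  · rintro ⟨h, hk⟩
    exact ⟨_, hk, h, rfl⟩

theorem ExEdge.ne {x y : ExVertex} (h : ExEdge x y) : x ≠ y := by
  cases h <;> simp_all

theorem ExEdge.adj {x y : ExVertex} (h : ExEdge x y) : exGraph.Adj x y :=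
  (SimpleGraph.fromRel_adj _ _ _).2 ⟨h.ne, Or.inl h⟩

theorem exGraph_adj {x y : ExVertex} (h : exGraph.Adj x y) : ExEdge x y ∨ ExEdge y x :=
  ((SimpleGraph.fromRel_adj _ _ _).1 h).2

theorem isClique_exB (n : ℕ) : exGraph.IsClique (exB n) := by
  rintro _ ⟨i, hi, rfl⟩ _ ⟨j, hj, rfl⟩ hne
  exact (ExEdge.complete n i j hi hj (fun h => hne (by subst h; rfl))).adj

/-- The vertices of the `n`-th complete graph. -/
def exBFinset (n : ℕ) : Finset ExVertex :=
  Finset.univ.map ⟨fun i : Fin (cliqueSize n) => ExVertex.clique n i i.2, by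
    intro i j h
    simpa [Fin.ext_iff] using h⟩

theorem card_exBFinset (n : ℕ) : (exBFinset n).card = cliqueSize n := by
  simp [exBFinset]

theorem coe_exBFinset (n : ℕ) : (exBFinset n : Set ExVertex) = exB n := by
  ext x
  simp only [exBFinset, Finset.coe_map, Set.mem_image, Finset.mem_coe, Finset.mem_univ, true_and]
  constructor
  · rintro ⟨i, rfl⟩
    exact ⟨i, i.2, rfl⟩
  · rintro ⟨i, hi, rfl⟩
    exact ⟨⟨i, hi⟩, rfl⟩

theorem mem_exBFinset {n : ℕ} {x : ExVertex} : x ∈ exBFinset n ↔ x ∈ exB n := by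
  rw [← coe_exBFinset, Finset.mem_coe]

theorem exB_nonempty (n : ℕ) : (exB n).Nonempty := ⟨_, 0, cliqueSize_pos n, rfl⟩

/-! ### Connectedness and local finiteness -/

theorem ExEdge.level_le {x y : ExVertex} (h : ExEdge x y) :
    x.level ≤ y.level + 1 ∧ y.level ≤ x.level + 1 := by
  cases h <;> simp only [ExVertex.level] <;> omega

theorem finite_level_le (m : ℕ) : {x : ExVertex | x.level ≤ m}.Finite := by
  have h₁ : (⋃ n ∈ Set.Iic m, exB n).Finite :=
    (Set.finite_Iic m).biUnion fun n _ => coe_exBFinset n ▸ (exBFinset n).finite_toSet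
  have h₂ : (Set.range fun p : (n : Fin m) × Fin (n + 1 + 2) =>
      ExVertex.w (p.1 + 1) p.2 (by omega) p.2.2).Finite := Set.finite_range _
  refine (h₁.union h₂).subset ?_
  rintro (⟨n, i, hi⟩ | ⟨n, i, hn, hi⟩) h
  · exact Or.inl (Set.mem_biUnion (show n ∈ Set.Iic m from h) ⟨i, hi, rfl⟩)
  · obtain ⟨n, rfl⟩ := Nat.exists_eq_add_of_le' hn
    exact Or.inr ⟨⟨⟨n, h⟩, ⟨i, hi⟩⟩, rfl⟩

theorem finite_neighborSet_exGraph (x : ExVertex) : (exGraph.neighborSet x).Finite := by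
  refine (finite_level_le (x.level + 1)).subset fun y hy => ?_
  rcases exGraph_adj hy with h | h
  · exact h.level_le.2
  · exact h.level_le.1

theorem exGraph_connected : exGraph.Connected := by
  have hB : ∀ {n x y}, x ∈ exB n → y ∈ exB n → exGraph.Reachable x y := by
    intro n x y hx hy
    by_cases h : x = y
    · rw [h]
    · exact (isClique_exB n hx hy h).reachable
  have h₀ : ∀ n, exGraph.Reachable (.clique n 0 (cliqueSize_pos n))
      (.clique 0 0 (cliqueSize_pos 0)) := by
    intro n
    induction n with
    | zero => rfl
    | succ n ih =>
      refine SimpleGraph.Reachable.trans ?_ ih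
      rcases Nat.eq_zero_or_pos n with rfl | hn
      · exact (ExEdge.redZero 0 (by norm_num) _ _).adj.symm.reachable
      · exact (ExEdge.red n 0 hn (by positivity)
          (two_pow_add_lt_cliqueSize hn (by positivity)) _).adj.symm.reachable.trans
          (hB ⟨_, _, rfl⟩ ⟨_, _, rfl⟩)
  have h : ∀ x, exGraph.Reachable x (.clique 0 0 (cliqueSize_pos 0)) := by
    rintro (⟨n, i, hi⟩ | ⟨n, i, hn, hi⟩)
    · exact (hB ⟨_, _, rfl⟩ ⟨_, _, rfl⟩).trans (h₀ n)
    -- A black edge exists only from level 2 on, so the route from a `w` first climbs one level.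
    · exact (ExEdge.blue n i 0 hn hi (by omega) (by omega)).adj.reachable.trans <|
        (ExEdge.black (n + 1) (by omega) (cliqueSize_pos _) (by omega)
          (by omega)).adj.symm.reachable.trans (h₀ (n + 1))
  exact (SimpleGraph.connected_iff _).2 ⟨fun x y => (h x).trans (h y).symm, ⟨.clique 0 0 (cliqueSize_pos 0)⟩⟩

/-! ### Families of edges -/

/-- The edges between the `n`-th and the `(n + 1)`-st complete graph. -/
def redDart (n : ℕ) (i : Fin (2 ^ (n + 1))) : ExVertex × ExVertex :=
  -- At level 0 both red edges leave the same vertex; there are `2 = 2 ^ (0 + 1)` of them, so one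
  -- index type serves all `n`.
  (.clique n (if n = 0 then 0 else 2 ^ n + i) (by
    split_ifs with h
    · exact cliqueSize_pos n
    · exact two_pow_add_lt_cliqueSize (by omega) i.2),
  .clique (n + 1) i (two_pow_lt_cliqueSize_succ i.2))

theorem redDart_injective (n : ℕ) : Function.Injective (redDart n) := by
  intro i j h
  simpa [redDart, Fin.ext_iff] using (Prod.ext_iff.1 h).2

theorem redDart_adj (n : ℕ) (i : Fin (2 ^ (n + 1))) :
    exGraph.Adj (redDart n i).1 (redDart n i).2 := by
  rcases Nat.eq_zero_or_pos n with rfl | hn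
  · exact (ExEdge.redZero i i.2 _ _).adj
  · have h := ExEdge.red n i hn i.2 (two_pow_add_lt_cliqueSize hn i.2)
      (two_pow_lt_cliqueSize_succ i.2)
    simpa [redDart, hn.ne'] using h.adj

theorem redDart_fst_mem (n : ℕ) (i : Fin (2 ^ (n + 1))) : (redDart n i).1 ∈ exB n := ⟨_, _, rfl⟩

theorem redDart_snd_mem (n : ℕ) (i : Fin (2 ^ (n + 1))) : (redDart n i).2 ∈ exB (n + 1) :=
  ⟨_, _, rfl⟩

/-- The edge between the `(j + 1)`-st complete graph and `w (j + 1) 0`. -/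
def blackDart (j : ℕ) : ExVertex × ExVertex :=
  (.clique (j + 1) 0 (cliqueSize_pos _), .w (j + 1) 0 (by omega) (by omega))

theorem blackDart_injective : Function.Injective blackDart := by
  intro i j h
  simpa [blackDart] using (Prod.ext_iff.1 h).1

theorem blackDart_adj {j : ℕ} (hj : 1 ≤ j) : exGraph.Adj (blackDart j).1 (blackDart j).2 :=
  (ExEdge.black (j + 1) (by omega) _ _ _).adj

/-- A lower bound on the size of a cut that has all red edges at `n` and the black edges between
`k` and `n`, and further edges `S`. -/
theorem card_add_le_encard_cut {n k : ℕ} {A : Set ExVertex} (hn : exB n ⊆ A)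
    (hn' : ∀ x ∈ exB (n + 1), x ∉ A) (hk : 2 ≤ k)
    (hB : ∀ j, k ≤ j → j ≤ n → exB j ⊆ A)
    (hW : ∀ j i hj hi, k ≤ j → j ≤ n → ExVertex.w j i hj hi ∉ A)
    {S : Finset (ExVertex × ExVertex)} (hS : (S : Set (ExVertex × ExVertex)) ⊆ cutDarts exGraph A)
    (hred : ∀ p ∈ S, p.1 ∈ exB n → p.2 ∈ exB (n + 1) → False)
    (hblack : ∀ p ∈ S, ¬ p.1.IsW → p.2.IsW → p.1.level = p.2.level → False) :
    ((S.card + 2 ^ (n + 1) + (n + 1 - k) : ℕ) : ℕ∞) ≤ (edgesBetween exGraph A Aᶜ).encard := by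
  classical
  set R := Finset.univ.image (redDart n)
  -- `blackDart j` lives at level `j + 1`, so these are the black edges at levels `k` to `n`; `2 ≤
  -- k` ensures that they exist.
  set K := (Finset.Ico (k - 1) n).image blackDart
  have hR : R.card = 2 ^ (n + 1) := by
    simp [R, Finset.card_image_of_injective _ (redDart_injective n)]
  have hKc : K.card = n + 1 - k := by
    rw [Finset.card_image_of_injective _ blackDart_injective, Nat.card_Ico]
    omega
  have hSR : Disjoint S R := by
    rw [Finset.disjoint_right]
    intro p hp hpS
    obtain ⟨i, -, rfl⟩ := Finset.mem_image.1 hp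
    exact hred _ hpS (redDart_fst_mem n i) (redDart_snd_mem n i)
  have hSRK : Disjoint (S ∪ R) K := by
    rw [Finset.disjoint_right]
    intro p hp hpS
    obtain ⟨j, -, rfl⟩ := Finset.mem_image.1 hp
    rcases Finset.mem_union.1 hpS with h | h
    · exact hblack _ h (fun h => h) trivial rfl
    · obtain ⟨i, -, e⟩ := Finset.mem_image.1 h
      have := (Prod.ext_iff.1 e).2
      simp [redDart, blackDart] at this
  rw [← hR, ← hKc, ← Finset.card_union_of_disjoint hSR, ← Finset.card_union_of_disjoint hSRK,
    ← Set.encard_coe_eq_coe_finsetCard, ← encard_cutDarts]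
  refine Set.encard_le_encard fun p hp => ?_
  simp only [Finset.coe_union, Set.mem_union, Finset.mem_coe] at hp
  rcases hp with (hp | hp) | hp
  · exact hS hp
  · obtain ⟨i, -, rfl⟩ := Finset.mem_image.1 hp
    exact ⟨hn (redDart_fst_mem n i), hn' _ (redDart_snd_mem n i), redDart_adj n i⟩
  · obtain ⟨j, hj, rfl⟩ := Finset.mem_image.1 hp
    rw [Finset.mem_Ico] at hj
    exact ⟨hB (j + 1) (by omega) (by omega) ⟨_, _, rfl⟩, hW _ _ _ _ (by omega) (by omega),
      blackDart_adj (by omega)⟩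

/-- The number of edges in the cut at `exSide n` that are not red edges at `n`. -/
def exExtra (n : ℕ) : ℕ := if n = 0 then 3 else n + 1

/-- This and the next three lemmas supply the sets `S` of extra cut edges, one for each way in which
`A` could deviate from `exSide n`. -/
theorem exists_redDarts_of_notMem {k : ℕ} {A : Set ExVertex} (h : exB (k + 1) ⊆ A)
    (h' : ∀ x ∈ exB k, x ∉ A) : ∃ S : Finset (ExVertex × ExVertex),
      (S : Set (ExVertex × ExVertex)) ⊆ cutDarts exGraph A ∧ S.card = 2 ^ (k + 1) ∧
      ∀ p ∈ S, p.1 ∈ exB (k + 1) ∧ p.2 ∈ exB k := by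
  refine ⟨Finset.univ.map ⟨fun i => (redDart k i).swap,
    Prod.swap_injective.comp (redDart_injective k)⟩, ?_, by simp, ?_⟩
  · intro p hp
    simp only [Finset.coe_map, Set.mem_image] at hp
    obtain ⟨i, -, rfl⟩ := hp
    exact ⟨h (redDart_snd_mem k i), h' _ (redDart_fst_mem k i), (redDart_adj k i).symm⟩
  · intro p hp
    obtain ⟨i, -, rfl⟩ := Finset.mem_map.1 hp
    exact ⟨redDart_snd_mem k i, redDart_fst_mem k i⟩

theorem exists_blueDarts_of_mem {k i : ℕ} {hk : 1 ≤ k} {hi : i < k + 2} {A : Set ExVertex}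
    (h : ExVertex.w k i hk hi ∈ A) (h' : ∀ j hk' hj, ExVertex.w (k + 1) j hk' hj ∉ A) :
    ∃ S : Finset (ExVertex × ExVertex),
      (S : Set (ExVertex × ExVertex)) ⊆ cutDarts exGraph A ∧ S.card = k + 3 ∧
      ∀ p ∈ S, p.1.IsW := by
  refine ⟨Finset.univ.map ⟨fun j : Fin (k + 1 + 2) =>
    (ExVertex.w k i hk hi, ExVertex.w (k + 1) j (by omega) j.2), ?_⟩, ?_, by simp, ?_⟩
  · intro a b e
    simpa [Fin.ext_iff] using e
  · intro p hp
    simp only [Finset.coe_map, Set.mem_image] at hp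
    obtain ⟨j, -, rfl⟩ := hp
    exact ⟨h, h' _ _ _, (ExEdge.blue k i j hk hi _ _).adj⟩
  · intro p hp
    obtain ⟨i, -, rfl⟩ := Finset.mem_map.1 hp
    trivial

theorem exists_blueZeroDarts {A : Set ExVertex} (h : exB 0 ⊆ A)
    (h' : ∀ j hk hj, ExVertex.w 1 j hk hj ∉ A) : ∃ S : Finset (ExVertex × ExVertex),
      (S : Set (ExVertex × ExVertex)) ⊆ cutDarts exGraph A ∧ S.card = 3 ∧
      ∀ p ∈ S, p.1 ∈ exB 0 ∧ p.2.IsW ∧ p.2.level = 1 := by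
  refine ⟨Finset.univ.map ⟨fun j : Fin (1 + 2) =>
    (ExVertex.clique 0 1 (one_lt_cliqueSize 0), ExVertex.w 1 j le_rfl j.2), ?_⟩, ?_, by simp, ?_⟩
  · intro a b e
    simpa [Fin.ext_iff] using e
  · intro p hp
    simp only [Finset.coe_map, Set.mem_image] at hp
    obtain ⟨j, -, rfl⟩ := hp
    exact ⟨h ⟨_, _, rfl⟩, h' _ _ _, (ExEdge.blueZero j _ _ _).adj⟩
  · intro p hp
    obtain ⟨i, -, rfl⟩ := Finset.mem_map.1 hp
    exact ⟨⟨_, _, rfl⟩, trivial, rfl⟩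

theorem exB_subset_or_disjoint_or_exists (k : ℕ) (A : Set ExVertex) :
    exB k ⊆ A ∨ (∀ x ∈ exB k, x ∉ A) ∨ ∃ S : Finset (ExVertex × ExVertex),
      (S : Set (ExVertex × ExVertex)) ⊆ cutDarts exGraph A ∧ S.card = cliqueSize k - 1 ∧
      ∀ p ∈ S, p.1 ∈ exB k ∧ p.2 ∈ exB k := by
  by_cases h₁ : exB k ⊆ A
  · exact Or.inl h₁
  by_cases h₂ : ∀ x ∈ exB k, x ∉ A
  · exact Or.inr (Or.inl h₂)
  obtain ⟨y, hy, hyA⟩ := Set.not_subset.1 h₁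
  push Not at h₂
  obtain ⟨x, hx, hxA⟩ := h₂
  have hc := isClique_exB k
  rw [← coe_exBFinset] at hc
  obtain ⟨S, hS, hcard, hSB⟩ := exists_cutDarts_of_split hc (mem_exBFinset.2 hx)
    (mem_exBFinset.2 hy) hxA hyA
  refine Or.inr (Or.inr ⟨S, hS, by rw [hcard, card_exBFinset], fun p hp => ?_⟩)
  exact ⟨mem_exBFinset.1 (hSB p hp).1, mem_exBFinset.1 (hSB p hp).2⟩

/-! ### Uniqueness of the minimum cuts -/

theorem exExtra_zero : exExtra 0 = 3 := if_pos rfl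

theorem exExtra_of_pos {n : ℕ} (hn : 1 ≤ n) : exExtra n = n + 1 := if_neg (by omega)

theorem exExtra_lt_two_pow {n k : ℕ} (h : n + 1 ≤ k) : exExtra n < 2 ^ (k + 1) := by
  have h₁ : 2 ^ (n + 2) ≤ 2 ^ (k + 1) := Nat.pow_le_pow_right (by norm_num) (by omega)
  have h₂ : n + 2 < 2 ^ (n + 2) := Nat.lt_two_pow_self
  rcases Nat.eq_zero_or_pos n with rfl | hn
  · rw [exExtra_zero]
    omega
  · rw [exExtra_of_pos hn]
    omega

variable {n : ℕ} {A : Set ExVertex}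

/-- In a cut of at most the size of the one at `exSide n`, apart from red edges at `n` and black
edges there is only room for a few edges. -/
theorem card_add_le_exExtra (hn : exB n ⊆ A) (hn' : ∀ x ∈ exB (n + 1), x ∉ A)
    (hle : (edgesBetween exGraph A Aᶜ).encard ≤ ((2 ^ (n + 1) + exExtra n : ℕ) : ℕ∞))
    {k : ℕ} (hk : 2 ≤ k) (hB : ∀ j, k ≤ j → j ≤ n → exB j ⊆ A)
    (hW : ∀ j i hj hi, k ≤ j → j ≤ n → ExVertex.w j i hj hi ∉ A)
    {S : Finset (ExVertex × ExVertex)} (hS : (S : Set (ExVertex × ExVertex)) ⊆ cutDarts exGraph A)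
    (hred : ∀ p ∈ S, p.1 ∈ exB n → p.2 ∈ exB (n + 1) → False)
    (hblack : ∀ p ∈ S, ¬ p.1.IsW → p.2.IsW → p.1.level = p.2.level → False) :
    S.card + (n + 1 - k) ≤ exExtra n := by
  have h := (card_add_le_encard_cut hn hn' hk hB hW hS hred hblack).trans hle
  rw [Nat.cast_le] at h
  omega

theorem card_le_exExtra (hn : exB n ⊆ A) (hn' : ∀ x ∈ exB (n + 1), x ∉ A)
    (hle : (edgesBetween exGraph A Aᶜ).encard ≤ ((2 ^ (n + 1) + exExtra n : ℕ) : ℕ∞))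
    {S : Finset (ExVertex × ExVertex)} (hS : (S : Set (ExVertex × ExVertex)) ⊆ cutDarts exGraph A)
    (hred : ∀ p ∈ S, p.1 ∈ exB n → p.2 ∈ exB (n + 1) → False)
    (hblack : ∀ p ∈ S, ¬ p.1.IsW → p.2.IsW → p.1.level = p.2.level → False) :
    S.card ≤ exExtra n := by
  -- With `k = n + 2` the range of black edges is empty.
  have := card_add_le_exExtra hn hn' hle (k := n + 2) (by omega) (fun j _ _ => by omega)
    (fun j _ _ _ _ _ => by omega) hS hred hblack
  omega

/-- Induction upwards: if `B_k` avoids `A`, then `B_{k+1} ⊆ A` costs `2 ^ (k + 1)` red edges and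
splitting `B_{k+1}` costs even more, both above `exExtra n`. -/
theorem exB_disjoint_of_lt (hn : exB n ⊆ A) (hn' : ∀ x ∈ exB (n + 1), x ∉ A)
    (hle : (edgesBetween exGraph A Aᶜ).encard ≤ ((2 ^ (n + 1) + exExtra n : ℕ) : ℕ∞))
    {k : ℕ} (hk : n + 1 ≤ k) : ∀ x ∈ exB k, x ∉ A := by
  induction k, hk using Nat.le_induction with
  | base => exact hn'
  | succ k hk ih =>
    have hpow := exExtra_lt_two_pow hk
    rcases exB_subset_or_disjoint_or_exists (k + 1) A with h | h | ⟨S, hS, hcard, hSB⟩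
    · obtain ⟨S, hS, hcard, hSB⟩ := exists_redDarts_of_notMem h ih
      have := card_le_exExtra hn hn' hle hS
        (fun p hp h₁ _ => by
          have := (mem_exB.1 h₁).2
          have := (mem_exB.1 (hSB p hp).1).2
          omega)
        (fun p hp _ h₂ _ => (mem_exB.1 (hSB p hp).2).1 h₂)
      omega
    · exact h
    · have := card_le_exExtra hn hn' hle hS
        (fun p hp h₁ _ => by
          have := (mem_exB.1 h₁).2
          have := (mem_exB.1 (hSB p hp).1).2
          omega)
        (fun p hp _ h₂ _ => (mem_exB.1 (hSB p hp).2).1 h₂)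
      rw [hcard, cliqueSize_of_pos (by omega), pow_succ, pow_succ] at this
      omega

/-- A `w` in `A` at level `m ≥ n` has `m + 3 > exExtra n` neighbours at level `m + 1`, so one of
them is in `A` as well. Thus `A` meets all later levels, which a finite cut cannot allow, because
the later cliques avoid `A`. -/
theorem w_notMem_of_le (hn : exB n ⊆ A) (hn' : ∀ x ∈ exB (n + 1), x ∉ A)
    (hle : (edgesBetween exGraph A Aᶜ).encard ≤ ((2 ^ (n + 1) + exExtra n : ℕ) : ℕ∞))
    {k i : ℕ} (hnk : n ≤ k) (hk : 1 ≤ k) (hi : i < k + 2) : ExVertex.w k i hk hi ∉ A := by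
  intro hmem
  have hfin : (cutDarts exGraph A).Finite := by
    rw [← Set.encard_lt_top_iff, encard_cutDarts]
    exact hle.trans_lt (ENat.natCast_lt_top _)
  obtain ⟨K, hK⟩ := (hfin.image fun p => p.1.level).bddAbove
  have hK' : ∀ p ∈ cutDarts exGraph A, p.1.level ≤ K := fun p hp => hK ⟨p, hp, rfl⟩
  have hup : ∀ m, k ≤ m → ∃ j hm hj, ExVertex.w m j hm hj ∈ A := by
    intro m hm
    induction m, hm using Nat.le_induction with
    | base => exact ⟨i, hk, hi, hmem⟩
    | succ m hm ih =>
      obtain ⟨j, hm', hj, h⟩ := ih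
      by_contra! hcon
      obtain ⟨S, hS, hcard, hSW⟩ := exists_blueDarts_of_mem h hcon
      have := card_le_exExtra hn hn' hle hS (fun p hp h₁ _ => (mem_exB.1 h₁).1 (hSW p hp))
        (fun p hp h₁ _ _ => h₁ (hSW p hp))
      unfold exExtra at this
      split_ifs at this <;> omega
  -- Beyond level `K` no cut edge starts, so `A` propagates along a blue edge to the `w` with a
  -- black edge and then into a clique that avoids `A`.
  obtain ⟨j, hm, hj, h⟩ := hup (max k K + 1) (by omega)
  have h₀ : ExVertex.w (max k K + 1 + 1) 0 (by omega) (by omega) ∈ A := by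
    by_contra hcon
    have := hK' (_, _) ⟨h, hcon, (ExEdge.blue _ _ _ _ _ _ _).adj⟩
    simp only [ExVertex.level] at this
    omega
  have := hK' (_, _) ⟨h₀, exB_disjoint_of_lt hn hn' hle (k := max k K + 1 + 1) (by omega) _
    ⟨0, cliqueSize_pos _, rfl⟩, (ExEdge.black _ (by omega) _ _ _).adj.symm⟩
  simp only [ExVertex.level] at this
  omega

/-- Downward induction from `n`: the black edges at the levels already settled lie in the cut and
use up the spare edges. -/
theorem exB_subset_and_w_notMem_of_le (hn : exB n ⊆ A) (hn' : ∀ x ∈ exB (n + 1), x ∉ A)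
    (hle : (edgesBetween exGraph A Aᶜ).encard ≤ ((2 ^ (n + 1) + exExtra n : ℕ) : ℕ∞))
    {k : ℕ} (hk : 1 ≤ k) (hkn : k ≤ n) :
    ∀ j, k ≤ j → j ≤ n → exB j ⊆ A ∧ ∀ i hj hi, ExVertex.w j i hj hi ∉ A := by
  refine Nat.decreasingInduction' (P := fun k => ∀ j, k ≤ j → j ≤ n →
    exB j ⊆ A ∧ ∀ i hj hi, ExVertex.w j i hj hi ∉ A) ?_ hkn ?_
  · intro m hmn hm ih j hj hjn
    rcases Nat.lt_or_ge m j with h | h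
    · exact ih j h hjn
    obtain rfl : j = m := by omega
    -- The `n - j` black edges at levels `j + 1` to `n` leave `(n + 1) - (n - j) = j + 1` edges. A
    -- deviating `w` needs `j + 3`, a missing `B_j` needs `2 ^ (j + 1)`, and a split one `2 ^ (j +
    -- 2) - 1`.
    have hroom : ∀ {S : Finset (ExVertex × ExVertex)},
        (S : Set (ExVertex × ExVertex)) ⊆ cutDarts exGraph A →
        (∀ p ∈ S, p.1 ∈ exB n → p.2 ∈ exB (n + 1) → False) →
        (∀ p ∈ S, ¬ p.1.IsW → p.2.IsW → p.1.level = p.2.level → False) → S.card ≤ j + 1 := by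
      intro S hS h₁ h₂
      have := card_add_le_exExtra hn hn' hle (k := j + 1) (by omega)
        (fun i hi hi' => (ih i hi hi').1) (fun i _ _ _ hi hi' => (ih i hi hi').2 _ _ _) hS h₁ h₂
      rw [exExtra_of_pos (by omega)] at this
      omega
    have hpow : j + 1 < 2 ^ (j + 1) := Nat.lt_two_pow_self
    have hW : ∀ i hj hi, ExVertex.w j i hj hi ∉ A := by
      intro i hj hi hmem
      obtain ⟨S, hS, hcard, hSW⟩ :=
        exists_blueDarts_of_mem hmem (ih (j + 1) le_rfl (by omega)).2
      have := hroom hS (fun p hp h₁ _ => (mem_exB.1 h₁).1 (hSW p hp))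
        (fun p hp h₁ _ _ => h₁ (hSW p hp))
      omega
    refine ⟨?_, hW⟩
    rcases exB_subset_or_disjoint_or_exists j A with h | h | ⟨S, hS, hcard, hSB⟩
    · exact h
    · obtain ⟨S, hS, hcard, hSB⟩ :=
        exists_redDarts_of_notMem (ih (j + 1) le_rfl (by omega)).1 h
      have := hroom hS
        (fun p hp _ h₂ => by
          have := (mem_exB.1 h₂).2
          have := (mem_exB.1 (hSB p hp).2).2
          omega)
        (fun p hp _ h₂ _ => (mem_exB.1 (hSB p hp).2).1 h₂)
      omega
    · have := hroom hS
        (fun p hp _ h₂ => by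
          have := (mem_exB.1 h₂).2
          have := (mem_exB.1 (hSB p hp).2).2
          omega)
        (fun p hp _ h₂ _ => (mem_exB.1 (hSB p hp).2).1 h₂)
      rw [hcard, cliqueSize_of_pos (by omega), pow_succ] at this
      omega
  · intro j hj hj'
    obtain rfl : j = n := by omega
    exact ⟨hn, fun i hj hi => w_notMem_of_le hn hn' hle le_rfl hj hi⟩

theorem exB_zero_disjoint (hpos : 1 ≤ n) (hn : exB n ⊆ A) (hn' : ∀ x ∈ exB (n + 1), x ∉ A)
    (hle : (edgesBetween exGraph A Aᶜ).encard ≤ ((2 ^ (n + 1) + exExtra n : ℕ) : ℕ∞)) :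
    ∀ x ∈ exB 0, x ∉ A := by
  have hlow := exB_subset_and_w_notMem_of_le hn hn' hle le_rfl hpos
  -- The `n - 1` black edges at levels 2 to `n` leave room for two more. Having `B_0` inside `A`
  -- would cost its three blue edges, splitting it nine.
  have hroom : ∀ {S : Finset (ExVertex × ExVertex)},
      (S : Set (ExVertex × ExVertex)) ⊆ cutDarts exGraph A →
      (∀ p ∈ S, p.1 ∈ exB 0) →
      (∀ p ∈ S, ¬ p.1.IsW → p.2.IsW → p.1.level = p.2.level → False) → S.card ≤ 2 := by
    intro S hS h₁ h₂
    have := card_add_le_exExtra hn hn' hle le_rfl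
      (fun i hi hi' => (hlow i (by omega) hi').1)
      (fun i _ _ _ hi hi' => (hlow i (by omega) hi').2 _ _ _) hS
      (fun p hp h _ => by
        have := (mem_exB.1 h).2
        have := (mem_exB.1 (h₁ p hp)).2
        omega) h₂
    rw [exExtra_of_pos hpos] at this
    omega
  rcases exB_subset_or_disjoint_or_exists 0 A with h | h | ⟨S, hS, hcard, hSB⟩
  · obtain ⟨S, hS, hcard, hSB⟩ := exists_blueZeroDarts h (hlow 1 le_rfl hpos).2
    have := hroom hS (fun p hp => (hSB p hp).1) (fun p hp _ _ e => by
      have := (mem_exB.1 (hSB p hp).1).2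
      have := (hSB p hp).2.2
      omega)
    omega
  · exact h
  · have := hroom hS (fun p hp => (hSB p hp).1)
      (fun p hp _ h₂ _ => (mem_exB.1 (hSB p hp).2).1 h₂)
    rw [hcard] at this
    simp [cliqueSize] at this

/-- `exSide n` is the only side of a cut of at most its size that contains `B_n` and avoids
`B_{n+1}`. -/
theorem eq_exSide_of_encard_le (hn : exB n ⊆ A) (hn' : ∀ x ∈ exB (n + 1), x ∉ A)
    (hle : (edgesBetween exGraph A Aᶜ).encard ≤ ((2 ^ (n + 1) + exExtra n : ℕ) : ℕ∞)) :
    A = exSide n := by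
  have hw : ∀ k i hk hi, ExVertex.w k i hk hi ∉ A := by
    intro k i hk hi
    rcases Nat.lt_or_ge k n with h | h
    · exact (exB_subset_and_w_notMem_of_le hn hn' hle hk h.le k le_rfl h.le).2 _ _ _
    · exact w_notMem_of_le hn hn' hle h hk hi
  ext x
  rcases Nat.eq_zero_or_pos n with rfl | hpos
  · rw [exSide_zero]
    rcases x with ⟨k, i, hi⟩ | ⟨k, i, hk, hi⟩
    · rcases Nat.eq_zero_or_pos k with rfl | hk
      · exact ⟨fun _ => ⟨_, _, rfl⟩, fun h => hn h⟩
      · refine iff_of_false (exB_disjoint_of_lt hn hn' hle hk _ ⟨_, _, rfl⟩) ?_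
        rw [clique_mem_exB]
        omega
    · exact iff_of_false (hw _ _ _ _) w_notMem_exB
  · rw [mem_exSide_of_pos hpos]
    rcases x with ⟨k, i, hi⟩ | ⟨k, i, hk, hi⟩
    · simp only [ExVertex.IsW, ExVertex.level, not_false_eq_true, true_and]
      rcases Nat.eq_zero_or_pos k with rfl | hk
      · exact iff_of_false (exB_zero_disjoint hpos hn hn' hle _ ⟨_, _, rfl⟩) (by omega)
      rcases Nat.lt_or_ge n k with h | h
      · exact iff_of_false (exB_disjoint_of_lt hn hn' hle h _ ⟨_, _, rfl⟩) (by omega)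
      · exact iff_of_true ((exB_subset_and_w_notMem_of_le hn hn' hle hk h k le_rfl h).1
          ⟨_, _, rfl⟩) ⟨hk, h⟩
    · exact iff_of_false (hw _ _ _ _) fun h => h.1 trivial

/-! ### Sizes of cuts -/

theorem encard_cut_le {B : Set ExVertex} {S : Finset (ExVertex × ExVertex)}
    (h : cutDarts exGraph B ⊆ S) : (edgesBetween exGraph B Bᶜ).encard ≤ (S.card : ℕ∞) := by
  rw [← encard_cutDarts, ← Set.encard_coe_eq_coe_finsetCard]
  exact Set.encard_le_encard h

theorem redDart_of_pos (hn : 1 ≤ n) {i : ℕ} (hi : i < 2 ^ (n + 1)) :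
    redDart n ⟨i, hi⟩ = (.clique n (2 ^ n + i) (two_pow_add_lt_cliqueSize hn hi),
      .clique (n + 1) i (two_pow_lt_cliqueSize_succ hi)) := by
  have : n ≠ 0 := by omega
  simp [redDart, this]

theorem encard_cut_exB_zero : (edgesBetween exGraph (exB 0) (exB 0)ᶜ).encard ≤ (5 : ℕ) := by
  classical
  let f : Fin 3 → ExVertex × ExVertex := fun j =>
    (.clique 0 1 (one_lt_cliqueSize 0), .w 1 j le_rfl j.2)
  refine (encard_cut_le
    (S := Finset.univ.image (redDart 0) ∪ Finset.univ.image f) ?_).trans ?_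
  · rintro ⟨a, b⟩ ⟨⟨l, hl, e⟩, hb, hab⟩
    simp only at e hb hab
    subst e
    simp only [Finset.coe_union, Finset.coe_image, Finset.coe_univ, Set.image_univ]
    rcases exGraph_adj hab with h | h
    · cases h with
      | complete => exact absurd ⟨_, _, rfl⟩ hb
      | red _ _ hn => omega
      | black _ hn => omega
      | redZero i hi => exact Or.inl ⟨⟨i, hi⟩, rfl⟩
      | blueZero i _ _ hi => exact Or.inr ⟨⟨i, hi⟩, rfl⟩
    · cases h with
      | complete => exact absurd ⟨_, _, rfl⟩ hb
  · refine Nat.cast_le.2 ((Finset.card_union_le _ _).trans ?_)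
    have h₁ := Finset.card_image_le (s := Finset.univ) (f := redDart 0)
    have h₂ := Finset.card_image_le (s := Finset.univ) (f := f)
    simp only [Finset.card_univ, Fintype.card_fin] at h₁ h₂
    omega

theorem encard_cut_exSide (n : ℕ) :
    (edgesBetween exGraph (exSide n) (exSide n)ᶜ).encard ≤ ((2 ^ (n + 1) + exExtra n : ℕ) : ℕ∞) := by
  classical
  rcases Nat.eq_zero_or_pos n with rfl | hpos
  · rw [exSide_zero]
    exact encard_cut_exB_zero
  -- The boundary consists of the red edges at `n`, the two red edges to `B_0` and the black edges
  -- at levels 2 to `n`.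
  refine (encard_cut_le (S := Finset.univ.image (redDart n) ∪
    (Finset.univ.image (fun i => (redDart 0 i).swap) ∪ (Finset.Ico 1 n).image blackDart)) ?_).trans ?_
  · rintro ⟨a, b⟩ ⟨ha, hb, hab⟩
    simp only [mem_exSide_of_pos hpos] at ha hb
    simp only at hab
    simp only [Finset.coe_union, Finset.coe_image, Finset.coe_univ, Set.image_univ]
    rcases exGraph_adj hab with h | h
    · cases h with
      | complete => exact absurd ha hb
      | red k i hk hi =>
        obtain rfl : k = n := by
          simp only [ExVertex.IsW, ExVertex.level, not_false_eq_true, true_and] at ha hb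
          omega
        exact Or.inl ⟨⟨i, hi⟩, redDart_of_pos hk hi⟩
      | blue => exact absurd trivial ha.1
      | black k hk =>
        obtain ⟨k, rfl⟩ := Nat.exists_eq_add_of_le' (show 1 ≤ k by omega)
        refine Or.inr (Or.inr ⟨k, ?_, rfl⟩)
        simp only [ExVertex.level] at ha
        simp only [Finset.coe_Ico, Set.mem_Ico]
        omega
      | redZero => exact absurd ha.2.1 (by simp [ExVertex.level])
      | blueZero => exact absurd ha.2.1 (by simp [ExVertex.level])
    · cases h with
      | complete => exact absurd ha hb
      | red k i hk hi =>
        simp only [ExVertex.IsW, ExVertex.level, not_false_eq_true, true_and] at ha hb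
        omega
      | blue => exact absurd trivial ha.1
      | black => exact absurd trivial ha.1
      | redZero i hi => exact Or.inr (Or.inl ⟨⟨i, hi⟩, rfl⟩)
      | blueZero => exact absurd trivial ha.1
  · refine Nat.cast_le.2 ((Finset.card_union_le _ _).trans
      ((Nat.add_le_add_left (Finset.card_union_le _ _) _).trans ?_))
    have h₁ := Finset.card_image_le (s := Finset.univ) (f := redDart n)
    have h₂ := Finset.card_image_le (s := Finset.univ) (f := fun i => (redDart 0 i).swap)
    have h₃ := Finset.card_image_le (s := Finset.Ico 1 n) (f := blackDart)
    simp only [Finset.card_univ, Fintype.card_fin, Nat.card_Ico] at h₁ h₂ h₃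
    rw [exExtra_of_pos hpos]
    omega

theorem encard_cut_exB_succ (m : ℕ) :
    (edgesBetween exGraph (exB (m + 1)) (exB (m + 1))ᶜ).encard ≤
      ((2 ^ (m + 2) + 2 ^ (m + 1) + (m + 1 - max m 1) : ℕ) : ℕ∞) := by
  classical
  -- The last interval is `{m}` for `m ≥ 1` and empty for `m = 0`, as `B_1` has no black edge.
  refine (encard_cut_le (S := Finset.univ.image (redDart (m + 1)) ∪
    (Finset.univ.image (fun i => (redDart m i).swap) ∪
      (Finset.Ico (max m 1) (m + 1)).image blackDart)) ?_).trans ?_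
  · rintro ⟨a, b⟩ ⟨ha, hb, hab⟩
    simp only [mem_exB] at ha hb
    simp only at hab
    simp only [Finset.coe_union, Finset.coe_image, Finset.coe_univ, Set.image_univ]
    rcases exGraph_adj hab with h | h
    · cases h with
      | complete => exact absurd ha hb
      | red k i hk hi =>
        obtain rfl : k = m + 1 := ha.2
        exact Or.inl ⟨⟨i, hi⟩, redDart_of_pos hk hi⟩
      | blue => exact absurd trivial ha.1
      | black k hk =>
        obtain rfl : k = m + 1 := ha.2
        refine Or.inr (Or.inr ⟨m, ?_, rfl⟩)
        simp only [Finset.coe_Ico, Set.mem_Ico]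
        omega
      | redZero => exact absurd ha.2 (by simp [ExVertex.level])
      | blueZero => exact absurd ha.2 (by simp [ExVertex.level])
    · cases h with
      | complete => exact absurd ha hb
      | red k i hk hi =>
        obtain rfl : k = m := Nat.succ_injective ha.2
        exact Or.inr (Or.inl ⟨⟨i, hi⟩, congrArg Prod.swap (redDart_of_pos hk hi)⟩)
      | blue => exact absurd trivial ha.1
      | black => exact absurd trivial ha.1
      | redZero i hi =>
        obtain rfl : 0 = m := Nat.succ_injective ha.2
        exact Or.inr (Or.inl ⟨⟨i, hi⟩, rfl⟩)
      | blueZero => exact absurd trivial ha.1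
  · refine Nat.cast_le.2 ((Finset.card_union_le _ _).trans
      ((Nat.add_le_add_left (Finset.card_union_le _ _) _).trans ?_))
    have h₁ := Finset.card_image_le (s := Finset.univ) (f := redDart (m + 1))
    have h₂ := Finset.card_image_le (s := Finset.univ) (f := fun i => (redDart m i).swap)
    have h₃ := Finset.card_image_le (s := Finset.Ico (max m 1) (m + 1)) (f := blackDart)
    simp only [Finset.card_univ, Fintype.card_fin, Nat.card_Ico] at h₁ h₂ h₃
    have h : 2 ^ (m + 2) = 2 ^ (m + 1 + 1) := rfl
    omega

theorem isKEdgeBlock_exBlock (n : ℕ) :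
    IsKEdgeBlock exGraph ((cliqueSize n - 1 : ℕ) : ℕ∞) (exBlock n) := by
  have hc := isClique_exB n
  rw [exBlock, ← coe_exBFinset, ← card_exBFinset]
  rw [← coe_exBFinset] at hc
  refine isKEdgeBlock_of_isClique hc ?_ ?_
  · rw [← Finset.coe_nonempty, coe_exBFinset]
    exact exB_nonempty n
  · rw [coe_exBFinset, card_exBFinset]
    cases n with
    | zero => exact encard_cut_exB_zero.trans_lt (Nat.cast_lt.2 (by simp [cliqueSize]))
    | succ m =>
      refine (encard_cut_exB_succ m).trans_lt (Nat.cast_lt.2 ?_)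
      rw [cliqueSize_of_pos (by omega)]
      have hm : m < 2 ^ m := Nat.lt_two_pow_self
      have h : 2 ^ (m + 1 + 2) = 8 * 2 ^ m := by ring
      have h' : 2 ^ (m + 2) = 4 * 2 ^ m := by ring
      have h'' : 2 ^ (m + 1) = 2 * 2 ^ m := by ring
      -- For `m = 0` the inequality is `6 < 7`, tight enough to need the missing black edge at level
      -- 1.
      rcases Nat.eq_zero_or_pos m with rfl | hm
      · norm_num
      · omega

/-! ### Efficient distinguishers -/

theorem exB_subset_exSide (n : ℕ) : exB n ⊆ exSide n := by
  intro x hx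
  rcases Nat.eq_zero_or_pos n with rfl | hpos
  · rwa [exSide_zero]
  · rw [mem_exB] at hx
    rw [mem_exSide_of_pos hpos]
    exact ⟨hx.1, by omega, by omega⟩

theorem exB_succ_subset_compl_exSide (n : ℕ) : exB (n + 1) ⊆ (exSide n)ᶜ := by
  intro x hx h
  rw [mem_exB] at hx
  rcases Nat.eq_zero_or_pos n with rfl | hpos
  · rw [exSide_zero, mem_exB] at h
    omega
  · rw [mem_exSide_of_pos hpos] at h
    omega

theorem distinguishes_exCut (n : ℕ) :
    Distinguishes exGraph (exCut n) (exBlock n) (exBlock (n + 1)) :=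
  distinguishes_of_isClique (isClique_exB _) (isClique_exB _) (exB_nonempty _) (exB_nonempty _)
    (exB_subset_exSide n) (exB_succ_subset_compl_exSide n)

/-- An edge set of at most the size of `exCut n` that distinguishes `B_n` and `B_{n+1}`
contains `exCut n`. -/
theorem exCut_subset_of_distinguishes {F : Set (Sym2 ExVertex)}
    (hF : Distinguishes exGraph F (exBlock n) (exBlock (n + 1)))
    (hle : F.encard ≤ (exCut n).encard) : exCut n ⊆ F := by
  obtain ⟨-, C, D, hCD, hC, hD⟩ := hF
  have hsub := edgesBetween_supp_subset C
  have hC' : C.supp = exSide n := by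
    refine eq_exSide_of_encard_le (fun x hx => hC.1 x ⟨x, hx, rfl⟩) (fun x hx h => hCD ?_)
      ((Set.encard_le_encard hsub).trans (hle.trans (encard_cut_exSide n)))
    exact SimpleGraph.ConnectedComponent.eq_of_common_vertex h (hD.1 x ⟨x, hx, rfl⟩)
  rwa [hC'] at hsub

theorem finite_exCut (n : ℕ) : (exCut n).Finite :=
  Set.encard_lt_top_iff.1 ((encard_cut_exSide n).trans_lt (ENat.natCast_lt_top _))

theorem distinguishesEfficiently_iff_eq_exCut {F : Set (Sym2 ExVertex)} :
    DistinguishesEfficiently exGraph F (exBlock n) (exBlock (n + 1)) ↔ F = exCut n := by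
  constructor
  · rintro ⟨hF, hmin⟩
    have hle := hmin _ (distinguishes_exCut n)
    -- Finiteness turns inclusion together with the size bound into equality.
    exact ((finite_exCut n).eq_of_subset_of_encard_le (exCut_subset_of_distinguishes hF hle) hle).symm
  · rintro rfl
    refine ⟨distinguishes_exCut n, fun F' hF' => ?_⟩
    by_contra! hlt
    exact hlt.not_ge (Set.encard_le_encard (exCut_subset_of_distinguishes hF' hlt.le))

theorem distinguishesEfficiently_cut_iff :
    DistinguishesEfficiently exGraph (edgesBetween exGraph A Aᶜ) (exBlock n) (exBlock (n + 1)) ↔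
      A = exSide n ∨ A = (exSide n)ᶜ := by
  rw [distinguishesEfficiently_iff_eq_exCut]
  constructor
  · exact eq_or_eq_compl_of_edgesBetween_eq exGraph_connected
  · rintro (rfl | rfl)
    · rfl
    · exact edgesBetween_compl_compl _

/-! ### The chain of order type `ω + 1` and the failure of tree-cut decompositions. -/

theorem exSide_ssubset_exSide {m : ℕ} (hn : 1 ≤ n) (hnm : n < m) : exSide n ⊂ exSide m := by
  rw [Set.ssubset_iff_exists]
  refine ⟨fun x hx => ?_, .clique m 0 (cliqueSize_pos m), exB_subset_exSide m ⟨_, _, rfl⟩, ?_⟩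
  · rw [mem_exSide_of_pos hn] at hx
    rw [mem_exSide_of_pos (by omega)]
    exact ⟨hx.1, by omega, by omega⟩
  · rw [mem_exSide_of_pos hn]
    simp only [ExVertex.level]
    omega

theorem exSide_ssubset_compl_exB_zero (hn : 1 ≤ n) : exSide n ⊂ (exSide 0)ᶜ := by
  rw [Set.ssubset_iff_exists, exSide_zero]
  refine ⟨fun x hx h => ?_, .w 1 0 le_rfl (by norm_num), w_notMem_exB, ?_⟩
  · rw [mem_exSide_of_pos hn] at hx
    rw [mem_exB] at h
    omega
  · rw [mem_exSide_of_pos hn]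
    exact fun h => h.1 trivial

theorem toDual_compl_lt_of_ssubset {V : Type*} {A B : Set V} (h : A ⊂ B) :
    ((A, OrderDual.toDual Aᶜ) : OrientedSep V) < (B, OrderDual.toDual Bᶜ) :=
  Prod.mk_lt_mk_of_lt_of_le h (OrderDual.toDual_le_toDual.2 (Set.compl_subset_compl.2 h.1))

theorem strictMono_exChain : StrictMono exChain := by
  intro a b hab
  induction a using WithTop.recTopCoe with
  | top => exact absurd hab not_top_lt
  | coe a =>
    induction b using WithTop.recTopCoe with
    | top =>
      have h := toDual_compl_lt_of_ssubset (exSide_ssubset_compl_exB_zero (n := a + 1) (by omega))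
      rw [compl_compl] at h
      exact h
    | coe b =>
      exact toDual_compl_lt_of_ssubset
        (exSide_ssubset_exSide (by omega) (by have := WithTop.coe_lt_coe.1 hab; omega))

theorem exCut_mem {M : Set (Set (Sym2 ExVertex))}
    (hM : DistinguishesAllEfficiently exGraph M) (n : ℕ) : exCut n ∈ M := by
  obtain ⟨F, hF, hdist⟩ := hM (exBlock n) (exBlock (n + 1)) ⟨_, isKEdgeBlock_exBlock n⟩
    ⟨_, isKEdgeBlock_exBlock (n + 1)⟩ (by
      rw [exBlock, exBlock, Set.disjoint_image_iff Sum.inl_injective, Set.disjoint_left]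
      exact fun x h => fun h' => exB_succ_subset_compl_exSide n h' (exB_subset_exSide n h))
  rwa [← distinguishesEfficiently_iff_eq_exCut.1 hdist]

theorem exCut_succ_injective : Function.Injective fun n => exCut (n + 1) := by
  intro a b h
  rcases eq_or_eq_compl_of_edgesBetween_eq exGraph_connected h with h | h
  · by_contra hne
    rcases Nat.lt_or_gt_of_ne hne with hlt | hlt
    · exact (exSide_ssubset_exSide (n := a + 1) (m := b + 1) (by omega) (by omega)).ne h
    · exact (exSide_ssubset_exSide (n := b + 1) (m := a + 1) (by omega) (by omega)).ne h.symm
  -- Complementary sides are impossible, since `B_0` lies outside every `exSide (n + 1)`.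
  · have hmem : ∀ n, ExVertex.clique 0 0 (cliqueSize_pos 0) ∉ exSide (n + 1) := by
      intro n
      rw [mem_exSide_of_pos (by omega)]
      simp [ExVertex.level]
    exact absurd (h.symm ▸ hmem b : ExVertex.clique 0 0 (cliqueSize_pos 0) ∈ exSide (a + 1)) (hmem a)

/-- A vertex of `B_0` and one of `B_1` are separated by the infinitely many distinct cuts `exCut (n
+ 1)`, reflecting that the chain has a limit element `F_0`. -/
theorem not_forall_exCut_mem_fundamentalCuts {ι : Type*} (D : TreeCutDecomposition ExVertex ι) :
    ¬ ∀ n, exCut n ∈ D.fundamentalCuts exGraph := by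
  intro h
  have hfin := D.finite_separating_cuts exGraph exGraph_connected
    (.clique 0 0 (cliqueSize_pos 0)) (.clique 1 0 (cliqueSize_pos 1))
  refine Set.infinite_of_injective_forall_mem exCut_succ_injective (fun n => ?_) hfin
  refine ⟨h (n + 1), exSide (n + 1), rfl, ?_⟩
  rw [mem_exSide_of_pos (by omega), mem_exSide_of_pos (by omega)]
  simp [ExVertex.level, ExVertex.IsW]

end Example

end EdgeBlocks
theorem mainTheorem4 :
    -- the example graph is connected and locally finite
    exGraph.Connected ∧
    (∀ x, (exGraph.neighborSet x).Finite) ∧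
    -- `B_0` is a `9`-edge-block, and `B_n` is a `(2 ^ (n + 2) - 1)`-edge-block for `n ≥ 1`
    IsKEdgeBlock exGraph 9 (exBlock 0) ∧
    (∀ n, 1 ≤ n → IsKEdgeBlock exGraph ((2 ^ (n + 2) - 1 : ℕ) : ℕ∞) (exBlock n)) ∧
    -- `F_n` is the only cut-separation that efficiently distinguishes `B_n` and `B_{n+1}`
    (∀ (n : ℕ) (A : Set ExVertex),
      DistinguishesEfficiently exGraph (edgesBetween exGraph A Aᶜ) (exBlock n) (exBlock (n + 1)) ↔
        A = exSide n ∨ A = (exSide n)ᶜ) ∧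
    -- the `F_n` form a chain of order type `ω + 1`
    StrictMono exChain ∧
    -- nested sets of cuts that efficiently distinguish all edge-blocks contain every `F_n`
    (∀ M : Set (Set (Sym2 ExVertex)), IsNestedSetOfCuts exGraph M →
      DistinguishesAllEfficiently exGraph M → ∀ n, exCut n ∈ M) ∧
    -- no nested set of cuts that efficiently distinguishes all edge-blocks is the set of
    -- fundamental cuts of a tree-cut decomposition
    ¬ ∃ M : Set (Set (Sym2 ExVertex)), IsNestedSetOfCuts exGraph M ∧
      DistinguishesAllEfficiently exGraph M ∧
      ∃ (ι : Type*) (D : TreeCutDecomposition ExVertex ι), D.fundamentalCuts exGraph = M := by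
  refine ⟨exGraph_connected, finite_neighborSet_exGraph, isKEdgeBlock_exBlock 0, fun n hn => ?_,
    fun n A => distinguishesEfficiently_cut_iff, strictMono_exChain, fun M _ hM => exCut_mem hM, ?_⟩
  · rw [← cliqueSize_of_pos hn]
    exact isKEdgeBlock_exBlock n
  · rintro ⟨M, -, hM, ι, D, rfl⟩
    exact not_forall_exCut_mem_fundamentalCuts D (exCut_mem hM)
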